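/- Let $\mathbb K$ be a field and $V$ a $\mathbb K$-vector space of finite positive dimension. A subspace $W\neq 0$ of $V$ is an eigenspace of $A\in\mathrm{End}(V)$ if $W=\{v\in V\mid Av=\theta v\}$ for some $\theta\in\mathbb K$ (the associated eigenvalue), and $A$ is diagonalizable if $V$ is spanned by the eigenspaces of $A$. For $A,B\in\mathrm{End}(V)$, an ordering $\{V_i\}_{i=0}^d$ (without repetition) of all the eigenspaces of $A$ is called standard with respect to $B$ if $BV_i\subseteq V_{i-1}+V_i+V_{i+1}$ for $0\le i\le d$, where $V_{-1}=V_{d+1}=0$. A tridiagonal pair on $V$ is a pair $A,A^*\in\mathrm{End}(V)$ of diagonalizable maps such that the eigenspaces of $A$ have an ordering that is standard with respect to $A^*$, the eigenspaces of $A^*$ have an ordering that is standard with respect to $A$, and there is no subspace $W$ of $V$ with $AW\subseteq W$, $A^*W\subseteq W$, $W\ne 0$, $W\ne V$. A tridiagonal system on $V$ is a sequence $\Phi=(A;\{E_i\}_{i=0}^d;A^*;\{E^*_i\}_{i=0}^d)$ of elements of $\mathrm{End}(V)$ such that $A,A^*$ is a tridiagonal pair; for some ordering $\{V_i\}_{i=0}^d$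 of the eigenspaces of $A$ that is standard with respect to $A^*$, each $E_i$ is the identity on $V_i$ and zero on $V_j$ for all $j\neq i$; and likewise $\{E^*_i\}_{i=0}^d$ for $A^*$ with respect to $A$. Let $\Phi$ be a tridiagonal system on $V$, and for $0\le i\le d$ let $\theta_i$ (resp. $\theta^*_i$) be the eigenvalue of $A$ (resp. $A^*$) associated with the eigenspace $E_iV$ (resp. $E^*_iV$). Let $T$ be the unital associative $\mathbb K$-algebra with generators $a,\{e_i\}_{i=0}^d,a^*,\{e^*_i\}_{i=0}^d$ and relations \[ e_ie_j=\delta_{i,j}e_i,\qquad e^*_ie^*_j=\delta_{i,j}e^*_i\qquad(0\le i,j\le d), \] \[ \sum_{i=0}^d e_i=1,\qquad \sum_{i=0}^d e^*_i=1,\qquad a=\sum_{i=0}^d\theta_ie_i,\qquad a^*=\sum_{i=0}^d\theta^*_ie^*_i, \] \[ e^*_ia^ke^*_j=0,\qquad e_i(a^*)^ke_j=0\qquad\text{if } k<|i-j| \qquad (0\le i,j,k\le d). \] Let $D$ be the $\mathbb K$-subalgebra of $T$ generated by $a$. Write $e^*_0De^*_0=\{e^*_0xe^*_0\mid x\in D\}$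 and let $e^*_0Te^*_0=\{e^*_0xe^*_0\mid x\in T\}$, a $\mathbb K$-algebra with identity $e^*_0$. Then: (i) the algebra $e^*_0Te^*_0$ is generated by $e^*_0De^*_0$; (ii) the elements of $e^*_0De^*_0$ mutually commute; (iii) the algebra $e^*_0Te^*_0$ is commutative. -/

import Mathlib

namespace TridiagonalSystems

section Pairs

variable {K V : Type*} [Field K] [AddCommGroup V] [Module K V]

/-- `W` is an eigenspace of `A`: it is nonzero and of the form `{v | A v = θ v}`. -/
def IsEigenspace (A : Module.End K V) (W : Submodule K V) : Prop :=
  W ≠ ⊥ ∧ ∃ θ : K, W = A.eigenspace θ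

/-- `A` is diagonalizable: `V` is spanned by the eigenspaces of `A`. -/
def IsDiagonalizable (A : Module.End K V) : Prop :=
  sSup {W : Submodule K V | IsEigenspace A W} = ⊤

/-- `W 0, …, W d` is an ordering (without repetition) of all the eigenspaces of `A`. -/
def IsEigenspaceOrdering (A : Module.End K V) {d : ℕ} (W : Fin (d + 1) → Submodule K V) : Prop :=
  Function.Injective W ∧ Set.range W = {U : Submodule K V | IsEigenspace A U}

/-- The ordering `W` of the eigenspaces of `A` is standard with respect to `B`:
`B W_i ⊆ W_{i-1} + W_i + W_{i+1}` for `0 ≤ i ≤ d`, where `W_{-1} = W_{d+1} = 0`. -/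
def IsStandardOrdering (A B : Module.End K V) {d : ℕ} (W : Fin (d + 1) → Submodule K V) : Prop :=
  IsEigenspaceOrdering A W ∧
    ∀ i : Fin (d + 1), (W i).map B ≤
      ⨆ j : Fin (d + 1), ⨆ _ : (i : ℕ) ≤ (j : ℕ) + 1 ∧ (j : ℕ) ≤ (i : ℕ) + 1, W j

/-- `A, As` is a tridiagonal pair on `V`. -/
structure IsTridiagonalPair (A As : Module.End K V) : Prop where
  diagonalizable : IsDiagonalizable A
  diagonalizable_dual : IsDiagonalizable As
  exists_standard : ∃ (d : ℕ) (W : Fin (d + 1) → Submodule K V), IsStandardOrdering A As W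
  exists_standard_dual : ∃ (δ : ℕ) (W : Fin (δ + 1) → Submodule K V), IsStandardOrdering As A W
  irreducible : ¬ ∃ W : Submodule K V, W.map A ≤ W ∧ W.map As ≤ W ∧ W ≠ ⊥ ∧ W ≠ ⊤

/-- `E 0, …, E d` is a standard ordering (with respect to `B`) of the primitive idempotents of `A`:
there is a standard ordering `W` of the eigenspaces of `A` such that `E i` is the identity
on `W i` and vanishes on `W j` for `j ≠ i`. -/
def IsStandardIdempotentOrdering (A B : Module.End K V) {d : ℕ}
    (E : Fin (d + 1) → Module.End K V) : Prop :=
  ∃ W : Fin (d + 1) → Submodule K V, IsStandardOrdering A B W ∧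
    (∀ i, ∀ v ∈ W i, E i v = v) ∧ (∀ i j, j ≠ i → ∀ v ∈ W j, E i v = 0)

/-- `(A; {E_i}; As; {Es_i})` is a tridiagonal system on `V` (of diameter `d`). -/
structure IsTridiagonalSystem {d : ℕ} (A : Module.End K V) (E : Fin (d + 1) → Module.End K V)
    (As : Module.End K V) (Es : Fin (d + 1) → Module.End K V) : Prop where
  pair : IsTridiagonalPair A As
  idempotents : IsStandardIdempotentOrdering A As E
  idempotents_dual : IsStandardIdempotentOrdering As A Es

/-- `θ i` is the eigenvalue of `A` associated with the eigenspace `E_i V`, for all `i`. -/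
def IsEigenvalueSequence {d : ℕ} (A : Module.End K V) (E : Fin (d + 1) → Module.End K V)
    (θ : Fin (d + 1) → K) : Prop :=
  ∀ i, LinearMap.range (E i) ≠ ⊥ ∧ LinearMap.range (E i) = A.eigenspace (θ i)

end Pairs

/-- The generators `a`, `e_i`, `a*`, `e*_i`. -/
inductive Gen (d : ℕ) : Type
  | a : Gen d
  | e : Fin (d + 1) → Gen d
  | as : Gen d
  | es : Fin (d + 1) → Gen d

section Algebra

variable {K : Type*} [Field K] {d : ℕ}

/-- The generator `g` in the free algebra. -/
abbrev free (K : Type*) [Field K] {d : ℕ} (g : Gen d) : FreeAlgebra K (Gen d) :=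
  FreeAlgebra.ι K g

/-- The defining relations of the algebra `T`. -/
inductive Rel (θ θs : Fin (d + 1) → K) : FreeAlgebra K (Gen d) → FreeAlgebra K (Gen d) → Prop
  | e_mul_e (i j : Fin (d + 1)) :
      Rel θ θs (free K (.e i) * free K (.e j)) (if i = j then free K (.e i) else 0)
  | es_mul_es (i j : Fin (d + 1)) :
      Rel θ θs (free K (.es i) * free K (.es j)) (if i = j then free K (.es i) else 0)
  | sum_e : Rel θ θs (∑ i, free K (.e i)) 1
  | sum_es : Rel θ θs (∑ i, free K (.es i)) 1
  | a_eq : Rel θ θs (free K .a) (∑ i, θ i • free K (.e i))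
  | as_eq : Rel θ θs (free K .as) (∑ i, θs i • free K (.es i))
  | es_a_es (i j : Fin (d + 1)) (k : ℕ) (hk : k ≤ d) (h : (k : ℤ) < |(i : ℤ) - (j : ℤ)|) :
      Rel θ θs (free K (.es i) * free K .a ^ k * free K (.es j)) 0
  | e_as_e (i j : Fin (d + 1)) (k : ℕ) (hk : k ≤ d) (h : (k : ℤ) < |(i : ℤ) - (j : ℤ)|) :
      Rel θ θs (free K (.e i) * free K .as ^ k * free K (.e j)) 0

/-- The unital associative `K`-algebra `T` defined by the generators and relations above. -/
abbrev T (θ θs : Fin (d + 1) → K) : Type _ := RingQuot (Rel θ θs)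

/-- The image in `T` of a generator. -/
noncomputable def gen (θ θs : Fin (d + 1) → K) (g : Gen d) : T θ θs :=
  RingQuot.mkAlgHom K (Rel θ θs) (free K g)

/-- The subalgebra `D` of `T` generated by `a`. -/
noncomputable def D (θ θs : Fin (d + 1) → K) : Subalgebra K (T θ θs) :=
  Algebra.adjoin K {gen θ θs .a}

/-- The element `e*_0` of `T`. -/
noncomputable def es0 (θ θs : Fin (d + 1) → K) : T θ θs := gen θ θs (.es 0)

/-- The set `e*_0 D e*_0`. -/
def es0Des0 (θ θs : Fin (d + 1) → K) : Set (T θ θs) :=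
  {y | ∃ x ∈ D θ θs, y = es0 θ θs * x * es0 θ θs}

/-- The algebra `e*_0 T e*_0`. Its identity element is `e*_0`, not the `1` of `T`, so inside `T`
it is a non-unital subalgebra. As `e*_0 = e*_0 1 e*_0` lies in `e*_0 D e*_0`, there is no difference
between being generated by `e*_0 D e*_0` with or without the identity `e*_0` adjoined. -/
def es0Tes0 (θ θs : Fin (d + 1) → K) : NonUnitalSubalgebra K (T θ θs) where
  carrier := {y | ∃ x : T θ θs, y = es0 θ θs * x * es0 θ θs}
  zero_mem' := ⟨0, by simp⟩
  add_mem' := by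
    rintro _ _ ⟨x, rfl⟩ ⟨y, rfl⟩
    exact ⟨x + y, by simp [mul_add, add_mul]⟩
  mul_mem' := by
    rintro _ _ ⟨x, rfl⟩ ⟨y, rfl⟩
    exact ⟨x * es0 θ θs * es0 θ θs * y, by simp [mul_assoc]⟩
  smul_mem' := by
    rintro c _ ⟨x, rfl⟩
    exact ⟨c • x, by simp⟩

end Algebra

end TridiagonalSystems

/-! The tridiagonal system supplies that the `θ i` are distinct, and so are the `θs i`; the argument
then runs inside `T`. Every `e i` is a Lagrange polynomial in `a`, and every `es i` one in `a*`, so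
`T` is spanned by alternating words in polynomials of `a` and of `a*`, and each power of one
generator is banded with respect to the idempotents of the other. The engine is a Vandermonde
argument, `banded_eq_zero`: a banded array with enough vanishing moments along rows and columns is
zero.

Commutativity (`zero_mul_aeval_comm`): `e*_0 p(a) u(a*) q(a) e*_0` is symmetric in `p` and `q`, by
induction on the degree of `u`; taking `u(a*) = e*_0` gives `corner_comm`.

Generation (`word_mem`): induction on the length of a word between two `e*_0`, and for a fixed
length on a degree bound `t` for one factor. If an end factor has degree at most `t`, its neighbour
can be lowered to degree below `t` up to a multiple of `e*_0`, which splits the word into two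
shorter ones. `sandwich_mem` carries this from the ends to an inner factor. Once `e*_0 T e*_0` is
generated by commuting elements, it is commutative. -/

open Polynomial

namespace TridiagonalSystems

/-! ### Vandermonde arguments for banded arrays of vectors -/

section Band

variable {K M : Type*} [Field K] [AddCommGroup M] [Module K M] {d : ℕ}

/-- A family of vectors supported on at most `n` indices vanishes as soon as it is annihilated by
all polynomials of degree less than `n` in the distinct nodes `θ`. -/
theorem eq_zero_of_sum_eval_smul_eq_zero {θ : Fin (d + 1) → K} (hθ : Function.Injective θ)
    {v : Fin (d + 1) → M} {n : ℕ} (s : Finset (Fin (d + 1))) (hs : s.card ≤ n)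
    (hv : ∀ i, i ∉ s → v i = 0)
    (h : ∀ p : K[X], p.degree < n → ∑ i, p.eval (θ i) • v i = 0) (i : Fin (d + 1)) : v i = 0 := by
  by_cases hi : i ∈ s
  · have hdeg : (Lagrange.basis s θ i).degree < n := by
      rw [Lagrange.degree_basis hθ.injOn hi]
      have : 0 < s.card := Finset.card_pos.mpr ⟨i, hi⟩
      exact_mod_cast (by omega : s.card - 1 < n)
    rw [← h _ hdeg, Finset.sum_eq_single i]
    · rw [Lagrange.eval_basis_self hθ.injOn hi, one_smul]
    · intro j _ hji
      by_cases hj : j ∈ s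
      · rw [Lagrange.eval_basis_of_ne hji.symm hj, zero_smul]
      · rw [hv j hj, smul_zero]
    · simp
  · exact hv i hi

theorem card_filter_interval_le (m n : ℕ) :
    (Finset.univ.filter fun i : Fin (d + 1) => m ≤ (i : ℕ) ∧ (i : ℕ) < m + n).card ≤ n := by
  have h : ((Finset.univ.filter fun i : Fin (d + 1) => m ≤ (i : ℕ) ∧ (i : ℕ) < m + n).image
      Fin.val) ⊆ Finset.Ico m (m + n) := by
    intro x hx
    simp only [Finset.mem_image, Finset.mem_filter, Finset.mem_univ, true_and] at hx
    obtain ⟨i, hi, rfl⟩ := hx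
    exact Finset.mem_Ico.mpr hi
  have h' := Finset.card_le_card h
  rwa [Finset.card_image_of_injective _ Fin.val_injective, Nat.card_Ico,
    Nat.add_sub_cancel_left] at h'

/-- A matrix of vectors with half-bandwidth `t` whose rows and columns are annihilated by the
polynomials of degree less than `t` vanishes if its diagonal vanishes or its rows are moreover
annihilated by the polynomials of degree `t`. -/
theorem banded_eq_zero {θ : Fin (d + 1) → K} (hθ : Function.Injective θ)
    {g : Fin (d + 1) → Fin (d + 1) → M} {t : ℕ}
    (hband : ∀ r s : Fin (d + 1), (t : ℤ) < |(r : ℤ) - (s : ℤ)| → g r s = 0)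
    (hrow : ∀ r, ∀ p : K[X], p.degree < t → ∑ s, p.eval (θ s) • g r s = 0)
    (hcol : ∀ s, ∀ p : K[X], p.degree < t → ∑ r, p.eval (θ r) • g r s = 0)
    (hdiag : (∀ r, g r r = 0) ∨
      ∀ r, ∀ p : K[X], p.degree < (t + 1 : ℕ) → ∑ s, p.eval (θ s) • g r s = 0)
    (r s : Fin (d + 1)) : g r s = 0 := by
  -- Peel off rows and columns in order. When those below `m` vanish, row `m` is supported on
  -- columns `m, …, m + t`. Either the diagonal entry is zero, leaving `t` unknowns, or `t + 1`
  -- moments are available. Column `m` then has only rows `m + 1, …, m + t` left.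
  have key : ∀ m : ℕ, ∀ r s : Fin (d + 1), ((r : ℕ) = m ∨ (s : ℕ) = m) → g r s = 0 := by
    intro m
    induction m using Nat.strong_induction_on with
    | _ m ih =>
      have hm : ∀ r s : Fin (d + 1), ((r : ℕ) < m ∨ (s : ℕ) < m) → g r s = 0 := by
        rintro r s (h | h)
        · exact ih r h r s (Or.inl rfl)
        · exact ih s h r s (Or.inr rfl)
      have hrowm : ∀ r s : Fin (d + 1), (r : ℕ) = m → g r s = 0 := by
        intro r s hr
        rcases hdiag with hd | hd
        · refine eq_zero_of_sum_eval_smul_eq_zero hθ (n := t) _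
            (card_filter_interval_le (m + 1) t) (fun i hi => ?_) (hrow r) s
          simp only [Finset.mem_filter, Finset.mem_univ, true_and] at hi
          rcases lt_trichotomy (i : ℕ) m with h | h | h
          · exact hm r i (Or.inr h)
          · rw [show i = r from Fin.ext (by omega)]
            exact hd r
          · refine hband r i ?_
            rw [abs_sub_comm, abs_of_nonneg (by omega)]
            omega
        · refine eq_zero_of_sum_eval_smul_eq_zero hθ (n := t + 1) _
            (card_filter_interval_le m (t + 1)) (fun i hi => ?_) (hd r) s
          simp only [Finset.mem_filter, Finset.mem_univ, true_and] at hi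
          rcases lt_or_ge (i : ℕ) m with h | h
          · exact hm r i (Or.inr h)
          · refine hband r i ?_
            rw [abs_sub_comm, abs_of_nonneg (by omega)]
            omega
      have hcolm : ∀ r s : Fin (d + 1), (s : ℕ) = m → g r s = 0 := by
        intro r s hs
        refine eq_zero_of_sum_eval_smul_eq_zero hθ (v := fun r => g r s) (n := t) _
          (card_filter_interval_le (m + 1) t) (fun i hi => ?_) (hcol s) r
        simp only [Finset.mem_filter, Finset.mem_univ, true_and] at hi
        rcases lt_trichotomy (i : ℕ) m with h | h | h
        · exact hm i s (Or.inl h)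
        · exact hrowm i s h
        · refine hband i s ?_
          rw [abs_of_nonneg (by omega)]
          omega
      rintro r s (h | h)
      · exact hrowm r s h
      · exact hcolm r s h
  exact key r r s (Or.inl rfl)

end Band

/-! ### Banded resolutions of the identity and commutativity of the corner -/

section Resolution

variable {K R : Type*} [Field K] [Ring R] [Algebra K R] {d : ℕ}

/-- `e` is a resolution of the identity into orthogonal idempotents, `a = ∑ θ_i e_i`, and the
`k`-th power of `b` is banded with half-bandwidth `k` with respect to `e`. -/
structure IsBandedResolution (θ : Fin (d + 1) → K) (e : Fin (d + 1) → R) (a b : R) : Prop where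
  mul_eq : ∀ i j, e i * e j = if i = j then e i else 0
  sum_eq : ∑ i, e i = 1
  eq_sum : a = ∑ i, θ i • e i
  band : ∀ (i j : Fin (d + 1)) (k : ℕ), (k : ℤ) < |(i : ℤ) - (j : ℤ)| → e i * b ^ k * e j = 0

namespace IsBandedResolution

variable {θ θs : Fin (d + 1) → K} {e es : Fin (d + 1) → R} {a b : R}

theorem aeval_eq (h : IsBandedResolution θ e a b) (p : K[X]) :
    aeval a p = ∑ i, p.eval (θ i) • e i := by
  have hmul : ∀ i, a * e i = θ i • e i := by
    intro i
    rw [h.eq_sum, Finset.sum_mul, Finset.sum_eq_single i]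
    · rw [smul_mul_assoc, h.mul_eq, if_pos rfl]
    · intro j _ hj
      rw [smul_mul_assoc, h.mul_eq, if_neg hj, smul_zero]
    · simp
  have hpow : ∀ (n : ℕ) i, a ^ n * e i = θ i ^ n • e i := by
    intro n i
    induction n with
    | zero => simp
    | succ n ih => rw [pow_succ, mul_assoc, hmul, mul_smul_comm, ih, smul_smul, pow_succ, mul_comm]
  have haeval : ∀ i, aeval a p * e i = p.eval (θ i) • e i := by
    intro i
    induction p using Polynomial.induction_on' with
    | add p q hp hq => rw [map_add, add_mul, hp, hq, eval_add, add_smul]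
    | monomial n c =>
      rw [aeval_monomial, mul_assoc, hpow, eval_monomial, ← Algebra.smul_def, smul_smul]
  rw [← mul_one (aeval a p), ← h.sum_eq, Finset.mul_sum]
  exact Finset.sum_congr rfl fun i _ => haeval i

theorem aeval_lagrange_basis (h : IsBandedResolution θ e a b) (hθ : Function.Injective θ)
    (i : Fin (d + 1)) : aeval a (Lagrange.basis Finset.univ θ i) = e i := by
  rw [h.aeval_eq, Finset.sum_eq_single i]
  · rw [Lagrange.eval_basis_self hθ.injOn (Finset.mem_univ i), one_smul]
  · intro j _ hji
    rw [Lagrange.eval_basis_of_ne hji.symm (Finset.mem_univ j), zero_smul]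
  · simp

theorem band_aeval (h : IsBandedResolution θ e a b) (i j : Fin (d + 1)) (p : K[X]) {n : ℕ}
    (hp : p.degree < n) (hn : (n : ℤ) ≤ |(i : ℤ) - (j : ℤ)|) : e i * aeval b p * e j = 0 := by
  rw [aeval_eq_sum_range, Finset.mul_sum, Finset.sum_mul]
  refine Finset.sum_eq_zero fun k _ => ?_
  rw [mul_smul_comm, smul_mul_assoc]
  by_cases hk : k < n
  · rw [h.band i j k (by omega), smul_zero]
  · rw [coeff_eq_zero_of_degree_lt (lt_of_lt_of_le hp (by exact_mod_cast not_lt.mp hk)), zero_smul]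

/-- Modulo a subspace, an element `x b^t y` with `x`, `y` polynomials in `a` can be reduced to those
with `x` of degree less than `t` or `y` of degree at most `t`. -/
theorem sandwich_mem (h : IsBandedResolution θ e a b) (hθ : Function.Injective θ)
    (S : Submodule K R) (l w : R) (t : ℕ)
    (h₁ : ∀ p q : K[X], p.degree < t → l * aeval a p * b ^ t * (aeval a q * w) ∈ S)
    (h₂ : ∀ p q : K[X], q.degree < (t + 1 : ℕ) → l * aeval a p * b ^ t * (aeval a q * w) ∈ S)
    (p q : K[X]) : l * aeval a p * b ^ t * (aeval a q * w) ∈ S := by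
  -- The array is taken modulo `S`. A Lagrange polynomial in one slot becomes an idempotent, so `h₂`
  -- gives `t + 1` moments for each row and `h₁` gives `t` for each column.
  have hg : ∀ r s, S.mkQ (l * e r * b ^ t * (e s * w)) = 0 := by
    have hrow : ∀ r, ∀ p : K[X], p.degree < (t + 1 : ℕ) →
        ∑ s, p.eval (θ s) • S.mkQ (l * e r * b ^ t * (e s * w)) = 0 := by
      intro r p hp
      have := h₂ (Lagrange.basis Finset.univ θ r) p hp
      rw [h.aeval_lagrange_basis hθ, h.aeval_eq p, Finset.sum_mul, Finset.mul_sum] at this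
      simp only [← map_smul, ← map_sum]
      rw [Submodule.mkQ_apply, Submodule.Quotient.mk_eq_zero]
      simpa only [smul_mul_assoc, mul_smul_comm] using this
    refine banded_eq_zero hθ (t := t) ?_ ?_ ?_ (Or.inr hrow)
    · intro r s hrs
      have : l * e r * b ^ t * (e s * w) = l * (e r * b ^ t * e s) * w := by
        simp only [mul_assoc]
      rw [this, h.band r s t hrs, mul_zero, zero_mul, map_zero]
    · exact fun r p hp => hrow r p (hp.trans (by exact_mod_cast Nat.lt_succ_self t))
    · intro s p hp
      have := h₁ p (Lagrange.basis Finset.univ θ s) hp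
      rw [h.aeval_lagrange_basis hθ, h.aeval_eq p, Finset.mul_sum, Finset.sum_mul,
        Finset.sum_mul] at this
      simp only [← map_smul, ← map_sum]
      rw [Submodule.mkQ_apply, Submodule.Quotient.mk_eq_zero]
      simpa only [smul_mul_assoc, mul_smul_comm] using this
  have hg' : ∀ r s, l * e r * b ^ t * (e s * w) ∈ S := fun r s => by
    rw [← Submodule.Quotient.mk_eq_zero, ← Submodule.mkQ_apply]
    exact hg r s
  rw [h.aeval_eq p, h.aeval_eq q, Finset.mul_sum, Finset.sum_mul, Finset.sum_mul]
  refine S.sum_mem fun r _ => ?_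
  rw [Finset.sum_mul, Finset.mul_sum]
  refine S.sum_mem fun s _ => ?_
  simpa only [smul_mul_assoc, mul_smul_comm] using S.smul_mem _ (S.smul_mem _ (hg' r s))

theorem aeval_mul_aeval_mul_zero_eq (hs : IsBandedResolution θs es b a)
    (u p : K[X]) :
    aeval b u * (aeval a p * es 0) = ∑ j, u.eval (θs j) • (es j * aeval a p * es 0) := by
  rw [hs.aeval_eq u, Finset.sum_mul]
  simp only [smul_mul_assoc, mul_assoc]

theorem zero_mul_aeval_mul_aeval_eq (hs : IsBandedResolution θs es b a)
    (u p : K[X]) :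
    es 0 * aeval a p * aeval b u = ∑ j, u.eval (θs j) • (es 0 * aeval a p * es j) := by
  rw [hs.aeval_eq u, Finset.mul_sum]
  simp only [mul_smul_comm]

theorem mul_aeval_mul_zero_eq_zero (hs : IsBandedResolution θs es b a)
    {p : K[X]} {t : ℕ} (hp : p.degree < t) {j : Fin (d + 1)}
    (hj : t ≤ (j : ℕ)) : es j * aeval a p * es 0 = 0 :=
  hs.band_aeval j 0 p hp (by simpa using hj)

theorem zero_mul_aeval_mul_eq_zero (hs : IsBandedResolution θs es b a)
    {p : K[X]} {t : ℕ} (hp : p.degree < t) {j : Fin (d + 1)}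
    (hj : t ≤ (j : ℕ)) : es 0 * aeval a p * es j = 0 :=
  hs.band_aeval 0 j p hp (by simpa using hj)

/-- By bandedness `p(a) e*_0` has components only in the `es j` with `j < t`, and `u(b)` acts on
each of them as the scalar `u(θs j)`. -/
theorem aeval_mul_congr (hs : IsBandedResolution θs es b a)
    {p u v : K[X]} {t : ℕ} (hp : p.degree < t)
    (huv : ∀ j : Fin (d + 1), (j : ℕ) < t → u.eval (θs j) = v.eval (θs j)) :
    aeval b u * (aeval a p * es 0) = aeval b v * (aeval a p * es 0) := by
  rw [hs.aeval_mul_aeval_mul_zero_eq, hs.aeval_mul_aeval_mul_zero_eq]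
  refine Finset.sum_congr rfl fun j _ => ?_
  rcases lt_or_ge (j : ℕ) t with hj | hj
  · rw [huv j hj]
  · rw [hs.mul_aeval_mul_zero_eq_zero hp hj, smul_zero, smul_zero]

theorem mul_aeval_congr (hs : IsBandedResolution θs es b a)
    {p u v : K[X]} {t : ℕ} (hp : p.degree < t)
    (huv : ∀ j : Fin (d + 1), (j : ℕ) < t → u.eval (θs j) = v.eval (θs j)) :
    es 0 * aeval a p * aeval b u = es 0 * aeval a p * aeval b v := by
  rw [hs.zero_mul_aeval_mul_aeval_eq, hs.zero_mul_aeval_mul_aeval_eq]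
  refine Finset.sum_congr rfl fun j _ => ?_
  rcases lt_or_ge (j : ℕ) t with hj | hj
  · rw [huv j hj]
  · rw [hs.zero_mul_aeval_mul_eq_zero hp hj, smul_zero, smul_zero]

/-- A polynomial agrees with one of degree less than `n` on `n` consecutive nodes. -/
theorem exists_degree_lt_eval_eq (hθs : Function.Injective θs) (u : K[X]) (m n : ℕ) :
    ∃ v : K[X], v.degree < n ∧
      ∀ j : Fin (d + 1), m ≤ (j : ℕ) → (j : ℕ) < m + n → u.eval (θs j) = v.eval (θs j) := by
  set s := Finset.univ.filter fun i : Fin (d + 1) => m ≤ (i : ℕ) ∧ (i : ℕ) < m + n with hsdef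
  refine ⟨Lagrange.interpolate s θs fun j => u.eval (θs j), ?_, fun j h₁ h₂ => ?_⟩
  · refine (Lagrange.degree_interpolate_lt _ hθs.injOn).trans_le ?_
    exact_mod_cast card_filter_interval_le m n
  · rw [Lagrange.eval_interpolate_at_node _ hθs.injOn]
    simp [hsdef, h₁, h₂]

theorem eval_add_C_mul_basis_eq (hθs : Function.Injective θs) {u v : K[X]} {t : ℕ}
    (hv : ∀ j : Fin (d + 1), 1 ≤ (j : ℕ) → (j : ℕ) < 1 + t → u.eval (θs j) = v.eval (θs j))
    (j : Fin (d + 1)) (hj : (j : ℕ) < t + 1) :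
    u.eval (θs j) = (v + C ((u - v).eval (θs 0)) * Lagrange.basis Finset.univ θs 0).eval (θs j) := by
  by_cases h0 : j = 0
  · subst h0
    simp [Lagrange.eval_basis_self hθs.injOn (Finset.mem_univ (0 : Fin (d + 1)))]
  · have : (j : ℕ) ≠ 0 := fun h => h0 (Fin.ext h)
    rw [hv j (by omega) (by omega)]
    simp [Lagrange.eval_basis_of_ne (v := θs) (Ne.symm h0) (Finset.mem_univ j)]

/-- For `p` of degree at most `t`, the element `u(b) p(a) e*_0` is, up to a multiple of
`e*_0 p(a) e*_0`, of the form `v(b) p(a) e*_0` with `v` of degree less than `t`. -/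
theorem exists_reduce_right (hs : IsBandedResolution θs es b a)
    (hθs : Function.Injective θs) (u p : K[X]) {t : ℕ}
    (hp : p.degree < (t + 1 : ℕ)) : ∃ (v : K[X]) (c : K), v.degree < t ∧
      aeval b u * (aeval a p * es 0) =
        aeval b v * (aeval a p * es 0) + c • (es 0 * (aeval a p * es 0)) := by
  -- The relevant nodes are `0, …, t`, one too many for degree below `t`. Leaving out node `0` puts
  -- the discrepancy on `es 0`, the idempotent at which a word can be cut.
  obtain ⟨v, hvdeg, hv⟩ := exists_degree_lt_eval_eq hθs u 1 t
  refine ⟨v, (u - v).eval (θs 0), hvdeg, ?_⟩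
  rw [hs.aeval_mul_congr hp (eval_add_C_mul_basis_eq hθs hv), map_add, map_mul,
    hs.aeval_lagrange_basis hθs, aeval_C, ← Algebra.smul_def, add_mul, smul_mul_assoc]

/-- The mirror image of `exists_reduce_right`. -/
theorem exists_reduce_left (hs : IsBandedResolution θs es b a)
    (hθs : Function.Injective θs) (u p : K[X]) {t : ℕ}
    (hp : p.degree < (t + 1 : ℕ)) : ∃ (v : K[X]) (c : K), v.degree < t ∧
      es 0 * aeval a p * aeval b u =
        es 0 * aeval a p * aeval b v + c • (es 0 * aeval a p * es 0) := by
  obtain ⟨v, hvdeg, hv⟩ := exists_degree_lt_eval_eq hθs u 1 t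
  refine ⟨v, (u - v).eval (θs 0), hvdeg, ?_⟩
  rw [hs.mul_aeval_congr hp (eval_add_C_mul_basis_eq hθs hv), map_add, map_mul,
    hs.aeval_lagrange_basis hθs, aeval_C, ← Algebra.smul_def, mul_add, mul_smul_comm]

theorem degree_lt_succ_decomp {p : K[X]} {t : ℕ} (hp : p.degree < (t + 1 : ℕ)) :
    ∃ (c : K) (q : K[X]), q.degree < t ∧ p = q + C c * X ^ t := by
  refine ⟨p.coeff t, p - C (p.coeff t) * X ^ t, ?_, by ring⟩
  rw [degree_lt_iff_coeff_zero]
  intro m hm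
  rw [coeff_sub, coeff_C_mul_X_pow]
  split_ifs with h
  · rw [h, sub_self]
  · rw [sub_zero, coeff_eq_zero_of_degree_lt]
    exact hp.trans_le (by exact_mod_cast (by omega : t + 1 ≤ m))

/-- Only the top term `b ^ t` of `u` needs work. Its antisymmetrized array in the indices of `e r`,
`e s` is banded with zero diagonal, and its moments of degree below `t` vanish because there `b ^ t`
can be traded for a polynomial of lower degree, where induction applies. -/
theorem zero_mul_aeval_comm (h : IsBandedResolution θ e a b) (hs : IsBandedResolution θs es b a)
    (hθ : Function.Injective θ) (hθs : Function.Injective θs) (t : ℕ) :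
    ∀ u : K[X], u.degree < t → ∀ p q : K[X],
      es 0 * aeval a p * aeval b u * (aeval a q * es 0) =
        es 0 * aeval a q * aeval b u * (aeval a p * es 0) := by
  induction t with
  | zero =>
    intro u hu p q
    have : u = 0 := by simpa using hu
    simp [this]
  | succ t ih =>
    have hmon : ∀ r s, es 0 * e r * b ^ t * (e s * es 0) - es 0 * e s * b ^ t * (e r * es 0)
        = 0 := by
      have hrow : ∀ r, ∀ p : K[X], p.degree < t → ∑ s, p.eval (θ s) •
          (es 0 * e r * b ^ t * (e s * es 0) - es 0 * e s * b ^ t * (e r * es 0)) = 0 := by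
        intro r p hp
        have hsum : ∑ s, p.eval (θ s) •
            (es 0 * e r * b ^ t * (e s * es 0) - es 0 * e s * b ^ t * (e r * es 0)) =
            es 0 * e r * b ^ t * (aeval a p * es 0) -
              es 0 * aeval a p * b ^ t * (e r * es 0) := by
          rw [h.aeval_eq p]
          simp only [Finset.mul_sum, Finset.sum_mul, smul_sub, Finset.sum_sub_distrib,
            smul_mul_assoc, mul_smul_comm]
        -- As `p` has degree below `t`, only the nodes `0, …, t - 1` are seen from either side, and
        -- on these `X ^ t` agrees with a `v` of degree below `t`.
        obtain ⟨v, hvdeg, hv⟩ := exists_degree_lt_eval_eq hθs (X ^ t) 0 t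
        have hv' : ∀ j : Fin (d + 1), (j : ℕ) < t → (X ^ t : K[X]).eval (θs j) = v.eval (θs j) :=
          fun j hj => hv j (Nat.zero_le _) (by omega)
        have hright := hs.aeval_mul_congr hp hv'
        have hleft := hs.mul_aeval_congr hp hv'
        rw [map_pow, aeval_X] at hright hleft
        have := ih v hvdeg (Lagrange.basis Finset.univ θ r) p
        rw [h.aeval_lagrange_basis hθ] at this
        rw [hsum, hleft, mul_assoc _ (b ^ t), hright, ← mul_assoc, this, sub_self]
      refine banded_eq_zero hθ (t := t) ?_ hrow ?_ (Or.inl fun r => sub_self _)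
      · intro r s hrs
        have h₁ : ∀ r s, es 0 * e r * b ^ t * (e s * es 0) = es 0 * (e r * b ^ t * e s) * es 0 := by
          intro r s
          simp only [mul_assoc]
        rw [h₁, h₁, h.band r s t hrs, h.band s r t (by rwa [abs_sub_comm]), sub_self]
      · intro s p hp
        have := hrow s p hp
        rw [← neg_eq_zero, ← Finset.sum_neg_distrib] at this
        rw [← this]
        refine Finset.sum_congr rfl fun r _ => ?_
        rw [← smul_neg, neg_sub]
    intro u hu p q
    obtain ⟨c, v, hv, rfl⟩ := degree_lt_succ_decomp hu
    have hmono : es 0 * aeval a p * b ^ t * (aeval a q * es 0) =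
        es 0 * aeval a q * b ^ t * (aeval a p * es 0) := by
      rw [h.aeval_eq p, h.aeval_eq q]
      simp only [Finset.mul_sum, Finset.sum_mul, smul_mul_assoc, mul_smul_comm, Finset.smul_sum]
      rw [Finset.sum_comm]
      refine Finset.sum_congr rfl fun s _ => Finset.sum_congr rfl fun r _ => ?_
      rw [smul_comm]
      rw [sub_eq_zero.mp (hmon s r)]
    rw [map_add, map_mul, aeval_C, map_pow, aeval_X, ← Algebra.smul_def]
    simp only [mul_add, add_mul, mul_smul_comm, smul_mul_assoc]
    rw [ih v hv p q, hmono]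

/-- The elements `e*_0 x e*_0`, with `x` a polynomial in `a`, commute. -/
theorem corner_comm (h : IsBandedResolution θ e a b) (hs : IsBandedResolution θs es b a)
    (hθ : Function.Injective θ) (hθs : Function.Injective θs) (p q : K[X]) :
    es 0 * aeval a p * es 0 * (es 0 * aeval a q * es 0) =
      es 0 * aeval a q * es 0 * (es 0 * aeval a p * es 0) := by
  have h0 : es 0 * es 0 = es 0 := by rw [hs.mul_eq, if_pos rfl]
  have key : ∀ x y : R, es 0 * x * es 0 * (es 0 * y * es 0) = es 0 * x * es 0 * (y * es 0) := by
    intro x y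
    rw [← mul_assoc, ← mul_assoc, mul_assoc (es 0 * x), h0]
    simp only [mul_assoc]
  -- This Lagrange polynomial has degree `d` and evaluates at `b` to `es 0`.
  have := zero_mul_aeval_comm h hs hθ hθs (d + 1) (Lagrange.basis Finset.univ θs 0) (by
    rw [Lagrange.degree_basis hθs.injOn (Finset.mem_univ _)]
    simp only [Finset.card_univ, Fintype.card_fin]
    exact_mod_cast Nat.lt_succ_self d) p q
  rw [hs.aeval_lagrange_basis hθs] at this
  rw [key, key, this]

end IsBandedResolution

end Resolution

/-! ### Alternating words and generation of the corner -/

section Words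

variable (K : Type*) {R : Type*} [Field K] [Ring R] [Algebra K R]

/-- The letters `a, b, a, b, …` of an alternating word. -/
def letter {R : Type*} (a b : R) (k : ℕ) : R := if Even k then a else b

/-- Products `f x₀ x₁ ⋯` of length `k`, with the `x_i` alternately polynomials in `a` and `b`. -/
def leftWords (a b f : R) : ℕ → Set R
  | 0 => {f}
  | k + 1 => {z | ∃ l ∈ leftWords a b f k, ∃ p : K[X], z = l * aeval (letter a b k) p}

/-- Products `⋯ x₁ x₀ f` of length `k`, with the `x_i` alternately polynomials in `a` and `b`. -/
def rightWords (a b f : R) : ℕ → Set R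
  | 0 => {f}
  | k + 1 => {z | ∃ w ∈ rightWords a b f k, ∃ p : K[X], z = aeval (letter a b k) p * w}

variable {K}

theorem letter_congr {R : Type*} (a b : R) {i j : ℕ} (h : Even (i + j)) : letter a b i = letter a b j := by
  have : Even i ↔ Even j := Nat.even_add.mp h
  simp only [letter, this]

theorem mul_mem_leftWords {a b f l : R} {k : ℕ} (hl : l ∈ leftWords K a b f k) (p : K[X]) :
    l * aeval (letter a b k) p ∈ leftWords K a b f (k + 1) :=
  ⟨l, hl, p, rfl⟩

theorem mul_mem_rightWords {a b f w : R} {k : ℕ} (hw : w ∈ rightWords K a b f k) (p : K[X]) :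
    aeval (letter a b k) p * w ∈ rightWords K a b f (k + 1) :=
  ⟨w, hw, p, rfl⟩

variable {d : ℕ} {θ θs : Fin (d + 1) → K} {e es : Fin (d + 1) → R} {a b : R}

/-- `a` and `b` play symmetric roles in `sandwich_mem`; the parity of `k` selects the resolution to
use. -/
theorem letter_sandwich_mem (h : IsBandedResolution θ e a b) (hs : IsBandedResolution θs es b a)
    (hθ : Function.Injective θ) (hθs : Function.Injective θs) (k : ℕ)
    (S : Submodule K R) (l w : R) (t : ℕ)
    (h₁ : ∀ p q : K[X], p.degree < t → l * aeval (letter a b k) p * letter a b (k + 1) ^ t *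
      (aeval (letter a b k) q * w) ∈ S)
    (h₂ : ∀ p q : K[X], q.degree < (t + 1 : ℕ) →
      l * aeval (letter a b k) p * letter a b (k + 1) ^ t * (aeval (letter a b k) q * w) ∈ S)
    (p q : K[X]) : l * aeval (letter a b k) p * letter a b (k + 1) ^ t *
      (aeval (letter a b k) q * w) ∈ S := by
  rcases Nat.even_or_odd k with hk | hk
  · have e₁ : letter a b k = a := if_pos hk
    have e₂ : letter a b (k + 1) = b := if_neg (by simpa [Nat.even_add_one] using hk)
    rw [e₁, e₂] at h₁ h₂ ⊢
    exact h.sandwich_mem hθ S l w t h₁ h₂ p q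
  · have hk' : ¬ Even k := Nat.not_even_iff_odd.mpr hk
    have e₁ : letter a b k = b := if_neg hk'
    have e₂ : letter a b (k + 1) = a := if_pos (by simpa [Nat.even_add_one] using hk')
    rw [e₁, e₂] at h₁ h₂ ⊢
    exact hs.sandwich_mem hθs S l w t h₁ h₂ p q

/-- If all shorter alternating words lie in `S`, then so do the alternating words of length
`2 n + 3` having some factor of degree less than `t`. -/
theorem word_mem_of_degree_lt (h : IsBandedResolution θ e a b)
    (hs : IsBandedResolution θs es b a) (hθ : Function.Injective θ) (hθs : Function.Injective θs)
    (S : NonUnitalSubalgebra K R) (n : ℕ)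
    (ih : ∀ m ≤ n, ∀ i j, i + j = 2 * m + 1 → ∀ l ∈ leftWords K a b (es 0) i,
      ∀ w ∈ rightWords K a b (es 0) j, l * w ∈ S) (t : ℕ) :
    ∀ j i, i + 1 + j = 2 * n + 3 → ∀ p : K[X], p.degree < t →
      ∀ l ∈ leftWords K a b (es 0) i, ∀ w ∈ rightWords K a b (es 0) j,
        l * aeval (letter a b i) p * w ∈ S := by
  have h0 : es 0 * es 0 = es 0 := by rw [hs.mul_eq, if_pos rfl]
  have l0 : letter a b 0 = a := if_pos (by decide)
  have l1 : letter a b 1 = b := if_neg (by decide)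
  induction t with
  | zero =>
    intro j i _ p hp l _ w _
    have : p = 0 := by simpa using hp
    simp [this]
  | succ t iht =>
    -- `j` counts the factors to the right of the distinguished one, so degree at most `t` is
    -- handled from the right end leftwards.
    intro j
    induction j with
    | zero =>
      intro i hij p hp l hl w hw
      obtain rfl : i = 2 * n + 1 + 1 := by omega
      obtain rfl : w = es 0 := hw
      obtain ⟨l, hl, u, rfl⟩ := hl
      have e₁ : letter a b (2 * n + 1 + 1) = a := by
        rw [letter_congr a b (j := 0) ⟨n + 1, by ring⟩, l0]
      have e₂ : letter a b (2 * n + 1) = b := by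
        rw [letter_congr a b (j := 1) ⟨n + 1, by ring⟩, l1]
      rw [e₁, e₂]
      -- The `v` term has a factor of degree below `t`, covered by `iht`; the `es 0` term is a
      -- product of two shorter words.
      obtain ⟨v, c, hv, huv⟩ := hs.exists_reduce_right hθs u p hp
      rw [mul_assoc, mul_assoc, huv, mul_add, mul_smul_comm]
      have hw1 := mul_mem_rightWords (K := K) (a := a) (b := b) (f := es 0) (k := 0) rfl p
      rw [l0] at hw1
      refine S.add_mem ?_ (S.smul_mem c ?_)
      · have := iht 1 (2 * n + 1) (by ring) v hv l hl _ hw1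
        rwa [e₂, mul_assoc] at this
      · have h₁ := ih n le_rfl (2 * n + 1) 0 (by ring) l hl (es 0) rfl
        have h₂ := ih 0 (Nat.zero_le n) 0 1 (by ring) (es 0) rfl _ hw1
        have := S.mul_mem h₁ h₂
        rwa [mul_assoc, ← mul_assoc (es 0) (es 0), h0] at this
    | succ j ihj =>
      intro i hij p hp l hl w hw
      obtain ⟨w, hw, q, rfl⟩ := hw
      rcases i with _ | i
      · obtain rfl : l = es 0 := hl
        obtain rfl : j = 2 * n + 1 := by omega
        have e₂ : letter a b (2 * n + 1) = b := by
          rw [letter_congr a b (j := 1) ⟨n + 1, by ring⟩, l1]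
        rw [l0, e₂]
        obtain ⟨v, c, hv, huv⟩ := hs.exists_reduce_left hθs q p hp
        rw [← mul_assoc, huv, add_mul, smul_mul_assoc]
        have hl1 := mul_mem_leftWords (K := K) (a := a) (b := b) (f := es 0) (k := 0) rfl p
        rw [l0] at hl1
        refine S.add_mem ?_ (S.smul_mem c ?_)
        · have := iht (2 * n + 1) 1 (by ring) v hv _ hl1 w hw
          rwa [l1] at this
        · have h₁ := ih n le_rfl 0 (2 * n + 1) (by ring) (es 0) rfl w hw
          have h₂ := ih 0 (Nat.zero_le n) 1 0 (by ring) _ hl1 (es 0) rfl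
          have := S.mul_mem h₂ h₁
          rwa [← mul_assoc, mul_assoc _ (es 0) (es 0), h0] at this
      · have hmono : ∀ l ∈ leftWords K a b (es 0) (i + 1),
            l * letter a b (i + 1) ^ t * (aeval (letter a b j) q * w) ∈ S := by
          rintro _ ⟨l, hl, r, rfl⟩
          have e₃ : letter a b j = letter a b i :=
            letter_congr a b ⟨n, by omega⟩
          have e₄ : letter a b (i + 1 + 1) = letter a b i :=
            letter_congr a b ⟨i + 1, by ring⟩
          have e₅ : letter a b (j + 1) = letter a b (i + 1) :=
            letter_congr a b ⟨n + 1, by omega⟩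
          have hX : ∀ x : R, aeval x (X ^ t : K[X]) = x ^ t := fun x => by simp
          rw [e₃]
          -- With `X ^ t` in the middle, a left neighbour of degree below `t` falls under `iht`, and
          -- a right neighbour of degree at most `t` under `ihj`, having fewer factors to its right.
          refine letter_sandwich_mem h hs hθ hθs i S.toSubmodule l w t ?_ ?_ r q
          · intro p q hp
            have hw2 := mul_mem_rightWords (mul_mem_rightWords hw q) (X ^ t)
            have := iht (j + 2) i (by omega) p hp l hl _ hw2
            rwa [hX, e₃, e₅, ← mul_assoc] at this
          · intro p q hq
            have hl2 := mul_mem_leftWords (mul_mem_leftWords hl p) (X ^ t)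
            have := ihj (i + 1 + 1) (by omega) q hq _ hl2 w hw
            rwa [hX, e₄, mul_assoc _ (aeval (letter a b i) q)] at this
        obtain ⟨c, v, hv, rfl⟩ := IsBandedResolution.degree_lt_succ_decomp hp
        rw [map_add, map_mul, aeval_C, map_pow, aeval_X, ← Algebra.smul_def, mul_add, add_mul,
          mul_smul_comm, smul_mul_assoc]
        exact S.add_mem (iht (j + 1) (i + 1) hij v hv l hl _ ⟨w, hw, q, rfl⟩)
          (S.smul_mem c (hmono l hl))

/-- The alternating words `e*_0 x₀ y₁ x₂ ⋯ x_{2n} e*_0` lie in the algebra generated by the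
elements `e*_0 x e*_0`. -/
theorem word_mem (h : IsBandedResolution θ e a b) (hs : IsBandedResolution θs es b a)
    (hθ : Function.Injective θ) (hθs : Function.Injective θs) (S : NonUnitalSubalgebra K R)
    (hS : ∀ p : K[X], es 0 * aeval a p * es 0 ∈ S) (n : ℕ) :
    ∀ i j, i + j = 2 * n + 1 → ∀ l ∈ leftWords K a b (es 0) i,
      ∀ w ∈ rightWords K a b (es 0) j, l * w ∈ S := by
  have l0 : letter a b 0 = a := if_pos (by decide)
  induction n using Nat.strong_induction_on with
  | _ n ih =>
    have key : ∀ j i, i + 1 + j = 2 * n + 1 → ∀ p : K[X], ∀ l ∈ leftWords K a b (es 0) i,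
        ∀ w ∈ rightWords K a b (es 0) j, l * aeval (letter a b i) p * w ∈ S := by
      intro j i hij p l hl w hw
      rcases n with _ | n
      · obtain rfl : i = 0 := by omega
        obtain rfl : j = 0 := by omega
        obtain rfl : l = es 0 := hl
        obtain rfl : w = es 0 := hw
        rw [l0]
        exact hS p
      · exact word_mem_of_degree_lt h hs hθ hθs S n (fun m hm => ih m (by omega))
          -- Any bound on the degree will do, so no word is excluded.
          (p.natDegree + 1) j i (by omega) p
          (degree_le_natDegree.trans_lt (by exact_mod_cast Nat.lt_succ_self _)) l hl w hw
    intro i j hij l hl w hw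
    rcases i with _ | i
    · obtain ⟨j, rfl⟩ : ∃ k, j = k + 1 := ⟨2 * n, by omega⟩
      obtain ⟨w, hw, p, rfl⟩ := hw
      have := key j 0 (by omega) p l hl w hw
      rwa [letter_congr a b (i := 0) (j := j) ⟨n, by omega⟩, mul_assoc] at this
    · obtain ⟨l, hl, p, rfl⟩ := hl
      exact key j i (by omega) p l hl w hw

/-- If `a` and `b` generate `R`, then the elements `e*_0 x e*_0` with `x` a polynomial in `a`
generate `e*_0 R e*_0`. -/
theorem corner_mem (h : IsBandedResolution θ e a b) (hs : IsBandedResolution θs es b a)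
    (hθ : Function.Injective θ) (hθs : Function.Injective θs)
    (htop : Algebra.adjoin K {a, b} = ⊤) (S : NonUnitalSubalgebra K R)
    (hS : ∀ p : K[X], es 0 * aeval a p * es 0 ∈ S) (x : R) : es 0 * x * es 0 ∈ S := by
  -- Words of odd length end in a polynomial in `a`. Their span absorbs right multiplication by `a`
  -- and `b`, hence by all of `R`.
  set M : Submodule K R :=
    Submodule.span K {z | ∃ n : ℕ, z ∈ leftWords K a b (es 0) (2 * n + 1)} with hM
  have l0 : ∀ n, letter a b (2 * n) = a := fun n => if_pos (by simp)
  have l1 : ∀ n, letter a b (2 * n + 1) = b := fun n => if_neg (by simp)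
  have hstep : ∀ y : R, (∀ n, ∀ l ∈ leftWords K a b (es 0) (2 * n + 1), l * y ∈ M) →
      ∀ m ∈ M, m * y ∈ M := by
    intro y hy m hm
    induction hm using Submodule.span_induction with
    | mem z hz =>
      obtain ⟨n, hz⟩ := hz
      exact hy n z hz
    | zero => simp
    | add u v _ _ hu hv => rw [add_mul]; exact M.add_mem hu hv
    | smul c u _ hu => rw [smul_mul_assoc]; exact M.smul_mem c hu
  have hmul : ∀ y : R, ∀ m ∈ M, m * y ∈ M := by
    intro y
    have hy : y ∈ Algebra.adjoin K {a, b} := by rw [htop]; trivial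
    induction hy using Algebra.adjoin_induction with
    | mem y hy =>
      refine hstep y fun n l hl => ?_
      rcases hy with rfl | rfl
      · obtain ⟨l, hl, p, rfl⟩ := hl
        refine Submodule.subset_span ⟨n, l, hl, p * X, ?_⟩
        rw [l0, map_mul, aeval_X, mul_assoc]
      -- Appending `b` makes the length even; the trivial factor `1` restores odd length.
      · refine Submodule.subset_span ⟨n + 1, _, mul_mem_leftWords hl X, 1, ?_⟩
        rw [l1, aeval_X, map_one, mul_one]
    | algebraMap c =>
      intro m hm
      rw [← Algebra.commutes, ← Algebra.smul_def]
      exact M.smul_mem c hm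
    | add u v _ _ hu hv =>
      intro m hm
      rw [mul_add]
      exact M.add_mem (hu m hm) (hv m hm)
    | mul u v _ _ hu hv =>
      intro m hm
      rw [← mul_assoc]
      exact hv _ (hu m hm)
  have hend : ∀ m ∈ M, m * es 0 ∈ S := by
    intro m hm
    induction hm using Submodule.span_induction with
    | mem z hz =>
      obtain ⟨n, hz⟩ := hz
      exact word_mem h hs hθ hθs S hS n (2 * n + 1) 0 (by ring) z hz (es 0) rfl
    | zero => simp
    | add u v _ _ hu hv => rw [add_mul]; exact S.add_mem hu hv
    | smul c u _ hu => rw [smul_mul_assoc]; exact S.smul_mem c hu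
  refine hend _ (hmul x _ (Submodule.subset_span ⟨0, es 0, rfl, 1, ?_⟩))
  rw [map_one, mul_one]

end Words

/-! ### Distinctness of the eigenvalues -/

section Eigenvalues

variable {K V : Type*} [Field K] [AddCommGroup V] [Module K V] {d : ℕ}

/-- Since the `W i` span `V`, the range of `E i` is exactly `W i`; equal eigenvalues would make two
of these eigenspaces coincide. -/
theorem eigenvalueSequence_injective {A B : Module.End K V} {E : Fin (d + 1) → Module.End K V}
    {θ : Fin (d + 1) → K} (hA : IsDiagonalizable A) (hE : IsStandardIdempotentOrdering A B E)
    (hθ : IsEigenvalueSequence A E θ) : Function.Injective θ := by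
  obtain ⟨W, ⟨⟨hinj, hrange⟩, -⟩, hid, hzero⟩ := hE
  have htop : ⨆ i, W i = ⊤ := by
    rw [← sSup_range, hrange]
    exact hA
  have hW : ∀ i, LinearMap.range (E i) = W i := by
    intro i
    refine le_antisymm ?_ fun v hv => ⟨v, hid i v hv⟩
    rw [LinearMap.range_eq_map, ← htop, Submodule.map_iSup]
    refine iSup_le fun j => ?_
    rintro _ ⟨v, hv, rfl⟩
    by_cases hj : j = i
    · subst hj
      rwa [hid j v hv]
    · rw [hzero i j hj v hv]
      exact (W i).zero_mem
  intro i j hij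
  apply hinj
  rw [← hW, ← hW, (hθ i).2, (hθ j).2, hij]

end Eigenvalues

/-! ### Transfer to the presented algebra `T` -/

section Presentation

variable {K : Type*} [Field K] {d : ℕ} (θ θs : Fin (d + 1) → K)

/-- Lets the relations of `T`, stated for `k ≤ d`, yield the band condition for all `k`. -/
theorem natCast_le_of_lt_abs_sub {i j : Fin (d + 1)} {k : ℕ}
    (h : (k : ℤ) < |(i : ℤ) - (j : ℤ)|) : k ≤ d := by
  have hi := i.is_lt
  have hj := j.is_lt
  rcases lt_abs.mp h with h | h <;> omega

theorem isBandedResolution_gen :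
    IsBandedResolution θ (fun i => gen θ θs (.e i)) (gen θ θs .a) (gen θ θs .as) where
  mul_eq i j := by
    have := RingQuot.mkAlgHom_rel K (Rel.e_mul_e (θ := θ) (θs := θs) i j)
    rw [map_mul] at this
    refine this.trans ?_
    split_ifs
    · rfl
    · exact map_zero _
  sum_eq := by
    have := RingQuot.mkAlgHom_rel K (Rel.sum_e (θ := θ) (θs := θs))
    rwa [map_sum, map_one] at this
  eq_sum := by
    have := RingQuot.mkAlgHom_rel K (Rel.a_eq (θ := θ) (θs := θs))
    simp only [map_sum, map_smul] at this
    exact this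
  band i j k hk := by
    have := RingQuot.mkAlgHom_rel K
      (Rel.e_as_e (θ := θ) (θs := θs) i j k (natCast_le_of_lt_abs_sub hk) hk)
    rwa [map_mul, map_mul, map_pow, map_zero] at this

theorem isBandedResolution_gen_dual :
    IsBandedResolution θs (fun i => gen θ θs (.es i)) (gen θ θs .as) (gen θ θs .a) where
  mul_eq i j := by
    have := RingQuot.mkAlgHom_rel K (Rel.es_mul_es (θ := θ) (θs := θs) i j)
    rw [map_mul] at this
    refine this.trans ?_
    split_ifs
    · rfl
    · exact map_zero _
  sum_eq := by
    have := RingQuot.mkAlgHom_rel K (Rel.sum_es (θ := θ) (θs := θs))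
    rwa [map_sum, map_one] at this
  eq_sum := by
    have := RingQuot.mkAlgHom_rel K (Rel.as_eq (θ := θ) (θs := θs))
    simp only [map_sum, map_smul] at this
    exact this
  band i j k hk := by
    have := RingQuot.mkAlgHom_rel K
      (Rel.es_a_es (θ := θ) (θs := θs) i j k (natCast_le_of_lt_abs_sub hk) hk)
    rwa [map_mul, map_mul, map_pow, map_zero] at this

variable {θ θs}

/-- For distinct eigenvalues the algebra `T` is generated by `a` and `a*`. -/
theorem adjoin_gen_eq_top (hθ : Function.Injective θ) (hθs : Function.Injective θs) :
    Algebra.adjoin K {gen θ θs .a, gen θ θs .as} = ⊤ := by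
  set B := Algebra.adjoin K {gen θ θs .a, gen θ θs .as} with hB
  have ha : gen θ θs .a ∈ B := Algebra.subset_adjoin (by simp)
  have has : gen θ θs .as ∈ B := Algebra.subset_adjoin (by simp)
  rw [eq_top_iff]
  rintro x -
  obtain ⟨y, rfl⟩ := RingQuot.mkAlgHom_surjective K (Rel θ θs) x
  induction y using FreeAlgebra.induction with
  | grade0 r => rw [AlgHom.commutes]; exact B.algebraMap_mem r
  | grade1 g =>
    change gen θ θs g ∈ B
    rcases g with _ | i | _ | i
    · exact ha
    · rw [← (isBandedResolution_gen θ θs).aeval_lagrange_basis hθ i]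
      exact Algebra.adjoin_mono (by simp) (Polynomial.aeval_mem_adjoin_singleton K _)
    · exact has
    · rw [← (isBandedResolution_gen_dual θ θs).aeval_lagrange_basis hθs i]
      exact Algebra.adjoin_mono (by simp) (Polynomial.aeval_mem_adjoin_singleton K _)
  | mul u v hu hv => rw [map_mul]; exact B.mul_mem hu hv
  | add u v hu hv => rw [map_add]; exact B.add_mem hu hv

theorem mem_es0Des0_iff {y : T θ θs} :
    y ∈ es0Des0 θ θs ↔ ∃ p : K[X], y = es0 θ θs * aeval (gen θ θs .a) p * es0 θ θs := by
  constructor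
  · rintro ⟨x, hx, rfl⟩
    obtain ⟨p, rfl⟩ := (Algebra.adjoin_singleton_eq_range_aeval K (gen θ θs .a)).le hx
    exact ⟨p, rfl⟩
  · rintro ⟨p, rfl⟩
    exact ⟨_, Polynomial.aeval_mem_adjoin_singleton K _, rfl⟩

end Presentation

end TridiagonalSystems

open TridiagonalSystems in
theorem theorem2p6 {K V : Type*} [Field K] [AddCommGroup V] [Module K V]
    [FiniteDimensional K V] [Nontrivial V] {d : ℕ}
    (A : Module.End K V) (E : Fin (d + 1) → Module.End K V)
    (As : Module.End K V) (Es : Fin (d + 1) → Module.End K V)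
    (hΦ : IsTridiagonalSystem A E As Es)
    (θ θs : Fin (d + 1) → K)
    (hθ : IsEigenvalueSequence A E θ) (hθs : IsEigenvalueSequence As Es θs) :
    NonUnitalAlgebra.adjoin K (es0Des0 θ θs) = es0Tes0 θ θs ∧
    (∀ x ∈ es0Des0 θ θs, ∀ y ∈ es0Des0 θ θs, x * y = y * x) ∧
    (∀ x ∈ es0Tes0 θ θs, ∀ y ∈ es0Tes0 θ θs, x * y = y * x) := by
  have iθ := eigenvalueSequence_injective hΦ.pair.diagonalizable hΦ.idempotents hθ
  have iθs := eigenvalueSequence_injective hΦ.pair.diagonalizable_dual hΦ.idempotents_dual hθs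
  have hr := isBandedResolution_gen θ θs
  have hrs := isBandedResolution_gen_dual θ θs
  have hgen : NonUnitalAlgebra.adjoin K (es0Des0 θ θs) = es0Tes0 θ θs := by
    apply le_antisymm
    · refine NonUnitalAlgebra.adjoin_le ?_
      rintro _ ⟨x, -, rfl⟩
      exact ⟨x, rfl⟩
    · rintro _ ⟨x, rfl⟩
      exact corner_mem hr hrs iθ iθs (adjoin_gen_eq_top iθ iθs) _
        (fun p => NonUnitalAlgebra.subset_adjoin K (mem_es0Des0_iff.mpr ⟨p, rfl⟩)) x
  have hcomm : ∀ x ∈ es0Des0 θ θs, ∀ y ∈ es0Des0 θ θs, x * y = y * x := by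
    intro x hx y hy
    obtain ⟨p, rfl⟩ := mem_es0Des0_iff.mp hx
    obtain ⟨q, rfl⟩ := mem_es0Des0_iff.mp hy
    exact IsBandedResolution.corner_comm hr hrs iθ iθs p q
  refine ⟨hgen, hcomm, ?_⟩
  rw [← hgen]
  intro x hx y hy
  induction hx, hy using NonUnitalAlgebra.adjoin_induction₂ with
  | mem_mem x y hx hy => exact hcomm x hx y hy
  | zero_left => simp
  | zero_right => simp
  | add_left x y z _ _ _ h₁ h₂ => rw [add_mul, mul_add, h₁, h₂]
  | add_right x y z _ _ _ h₁ h₂ => rw [add_mul, mul_add, h₁, h₂]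
  | mul_left x y z _ _ _ h₁ h₂ => rw [mul_assoc, h₂, ← mul_assoc, h₁, mul_assoc]
  | mul_right x y z _ _ _ h₁ h₂ => rw [← mul_assoc, h₁, mul_assoc, h₂, mul_assoc]
  | smul_left r x y _ _ h => rw [smul_mul_assoc, mul_smul_comm, h]
  | smul_right r x y _ _ h => rw [smul_mul_assoc, mul_smul_comm, h]
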